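/- Let $\mathcal C$ be a cycle of length $|\mathcal C|>0$, and for points $p,q\in\mathcal C$ let $|\overrightarrow{pq}|$ be the length of the clockwise arc of $\mathcal C$ from $p$ to $q$; the distance of $p$ and $q$ is $|pq|=\min\{|\overrightarrow{pq}|,|\overrightarrow{qp}|\}$. Let $I_1,\dots,I_n$ ($n\ge 1$) be pairwise disjoint closed intervals (arcs) on $\mathcal C$, where $I_i$ is the arc from $l_i$ clockwise to $r_i$, given in their cyclic (clockwise) order. The cycle version of the points dispersion problem asks for points $p_i\in I_i$ ($1\le i\le n$) that maximize $\min_{1\le i<j\le n}|p_ip_j|$. This problem is solvable in $O(n)$ time in the real RAM model: there are a program and a constant $c$ such that, on every such input ($n$, $|\mathcal C|$ and the clockwise coordinates in $[0,|\mathcal C|)$ of $l_1,\dots,l_n$ and $r_1,\dots,r_n$), the program halts after at most $c\,n$ steps and outputs the coordinates of an optimal solution $p_1,\dots,p_n$. -/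

import Mathlib

/-! ### A real RAM

The memory has integer registers, real registers, integer arrays and real arrays. A program is a
finite text, so it mentions only finitely many registers and arrays, by fixed names; the cells of an
array are addressed indirectly, through an integer register. Reals are exact. Every elementary
instruction and every test costs one step. There is no rounding and no conversion from reals to
integers. -/

namespace RealRAM

/-- The memory: `ireg x`, `rreg x` are the integer and real registers with name `x`; `iarr a i`,
`rarr a i` are the cells with index `i` of the integer and real arrays with name `a`. -/
structure Mem where
  ireg : ℕ → ℕ
  rreg : ℕ → ℝ
  iarr : ℕ → ℕ → ℕ
  rarr : ℕ → ℕ → ℝ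

/-- Elementary instructions. The arguments are names of registers and arrays, except for the literal
`k` in `iconst`. -/
inductive Instr where
  /-- integer register `x` becomes the literal `k` -/
  | iconst (x k : ℕ)
  /-- integer register `x` becomes `y + z` -/
  | iadd (x y z : ℕ)
  /-- integer register `x` becomes `y - z`, or `0` if `y < z` -/
  | isub (x y z : ℕ)
  /-- integer register `x` becomes cell `i` of integer array `a`, `i` an integer register -/
  | iload (x a i : ℕ)
  /-- cell `i` of integer array `a` becomes `x`, `i` and `x` integer registers -/
  | istore (a i x : ℕ)
  /-- real register `u` becomes the value of the integer register `x` -/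
  | rcast (u x : ℕ)
  /-- real register `u` becomes `v + w` -/
  | radd (u v w : ℕ)
  /-- real register `u` becomes `v - w` -/
  | rsub (u v w : ℕ)
  /-- real register `u` becomes `v * w` -/
  | rmul (u v w : ℕ)
  /-- real register `u` becomes `v / w` (and `0` if `w = 0`) -/
  | rdiv (u v w : ℕ)
  /-- real register `u` becomes cell `i` of real array `a`, `i` an integer register -/
  | rload (u a i : ℕ)
  /-- cell `i` of real array `a` becomes `u`, `i` an integer register, `u` a real register -/
  | rstore (a i u : ℕ)

/-- The effect of an elementary instruction on the memory. -/
noncomputable def Instr.apply (m : Mem) : Instr → Mem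
  | .iconst x k => { m with ireg := Function.update m.ireg x k }
  | .iadd x y z => { m with ireg := Function.update m.ireg x (m.ireg y + m.ireg z) }
  | .isub x y z => { m with ireg := Function.update m.ireg x (m.ireg y - m.ireg z) }
  | .iload x a i => { m with ireg := Function.update m.ireg x (m.iarr a (m.ireg i)) }
  | .istore a i x => { m with
      iarr := Function.update m.iarr a (Function.update (m.iarr a) (m.ireg i) (m.ireg x)) }
  | .rcast u x => { m with rreg := Function.update m.rreg u (m.ireg x : ℝ) }
  | .radd u v w => { m with rreg := Function.update m.rreg u (m.rreg v + m.rreg w) }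
  | .rsub u v w => { m with rreg := Function.update m.rreg u (m.rreg v - m.rreg w) }
  | .rmul u v w => { m with rreg := Function.update m.rreg u (m.rreg v * m.rreg w) }
  | .rdiv u v w => { m with rreg := Function.update m.rreg u (m.rreg v / m.rreg w) }
  | .rload u a i => { m with rreg := Function.update m.rreg u (m.rarr a (m.ireg i)) }
  | .rstore a i u => { m with
      rarr := Function.update m.rarr a (Function.update (m.rarr a) (m.ireg i) (m.rreg u)) }

/-- Elementary tests: comparisons of two integer registers or of two real registers. -/
inductive Test where
  | ilt (x y : ℕ)
  | ile (x y : ℕ)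
  | rlt (u v : ℕ)
  | rle (u v : ℕ)

/-- The outcome of a test. -/
def Test.Holds (m : Mem) : Test → Prop
  | .ilt x y => m.ireg x < m.ireg y
  | .ile x y => m.ireg x ≤ m.ireg y
  | .rlt u v => m.rreg u < m.rreg v
  | .rle u v => m.rreg u ≤ m.rreg v

/-- Structured programs. -/
inductive Prog where
  | skip
  | instr (a : Instr)
  | seq (p q : Prog)
  | ite (b : Test) (p q : Prog)
  | loop (b : Test) (p : Prog)

/-- `Exec p m t m'`: the program `p`, started with memory `m`, halts after exactly `t` steps with
memory `m'`. The program `loop b p` is "while `b` do `p`". -/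
inductive Exec : Prog → Mem → ℕ → Mem → Prop
  | skip (m : Mem) : Exec .skip m 1 m
  | instr (a : Instr) (m : Mem) : Exec (.instr a) m 1 (a.apply m)
  | seq {p q : Prog} {m m₁ m₂ : Mem} {s t : ℕ} :
      Exec p m s m₁ → Exec q m₁ t m₂ → Exec (.seq p q) m (s + t) m₂
  | ite_true {b : Test} {p q : Prog} {m m₁ : Mem} {t : ℕ} :
      b.Holds m → Exec p m t m₁ → Exec (.ite b p q) m (1 + t) m₁
  | ite_false {b : Test} {p q : Prog} {m m₁ : Mem} {t : ℕ} :
      ¬ b.Holds m → Exec q m t m₁ → Exec (.ite b p q) m (1 + t) m₁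
  | loop_true {b : Test} {p : Prog} {m m₁ m₂ : Mem} {s t : ℕ} :
      b.Holds m → Exec p m s m₁ → Exec (.loop b p) m₁ t m₂ → Exec (.loop b p) m (1 + s + t) m₂
  | loop_false {b : Test} {p : Prog} {m : Mem} :
      ¬ b.Holds m → Exec (.loop b p) m 1 m

/-- The machine is deterministic, so that a halting execution is the only one. -/
theorem Exec.deterministic {p : Prog} {m m₁ m₂ : Mem} {s t : ℕ}
    (h₁ : Exec p m s m₁) (h₂ : Exec p m t m₂) : s = t ∧ m₁ = m₂ := by
  induction h₁ generalizing t m₂ with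
  | skip m => cases h₂; exact ⟨rfl, rfl⟩
  | instr a m => cases h₂; exact ⟨rfl, rfl⟩
  | seq _ _ ih₁ ih₂ =>
    cases h₂ with
    | seq k₁ k₂ =>
      obtain ⟨rfl, rfl⟩ := ih₁ k₁
      obtain ⟨rfl, rfl⟩ := ih₂ k₂
      exact ⟨rfl, rfl⟩
  | ite_true hb _ ih =>
    cases h₂ with
    | ite_true _ k => obtain ⟨rfl, rfl⟩ := ih k; exact ⟨rfl, rfl⟩
    | ite_false hn _ => exact absurd hb hn
  | ite_false hb _ ih =>
    cases h₂ with
    | ite_true hn _ => exact absurd hn hb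
    | ite_false _ k => obtain ⟨rfl, rfl⟩ := ih k; exact ⟨rfl, rfl⟩
  | loop_true hb _ _ ih₁ ih₂ =>
    cases h₂ with
    | loop_true _ k₁ k₂ =>
      obtain ⟨rfl, rfl⟩ := ih₁ k₁
      obtain ⟨rfl, rfl⟩ := ih₂ k₂
      exact ⟨rfl, rfl⟩
    | loop_false hn => exact absurd hb hn
  | loop_false hb =>
    cases h₂ with
    | loop_true hn _ _ => exact absurd hn hb
    | loop_false _ => exact ⟨rfl, rfl⟩

end RealRAM

/-! ### Dispersing points on intervals of a cycle

The cycle of length `L` is `AddCircle L`, that is `ℝ / Lℤ`, clockwise being the direction of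
increasing coordinates. -/

namespace CycleDispersion

/-- The coordinate in `[0, L)` of a point of the cycle. -/
noncomputable def coord {L : ℝ} [Fact (0 < L)] (p : AddCircle L) : ℝ :=
  (AddCircle.equivIco L 0 p : ℝ)

/-- The length of the clockwise arc from `p` to `q`. -/
noncomputable def cw {L : ℝ} [Fact (0 < L)] (p q : AddCircle L) : ℝ := coord (q - p)

/-- The distance on the cycle: the length of the shorter arc. -/
noncomputable def cycleDist {L : ℝ} [Fact (0 < L)] (p q : AddCircle L) : ℝ :=
  min (cw p q) (cw q p)

/-- The closed interval that is swept when moving clockwise from `l` to `r`. -/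
def arc {L : ℝ} [Fact (0 < L)] (l r : AddCircle L) : Set (AddCircle L) :=
  {x | cw l x ≤ cw l r}

/-- The intervals `arc (l i) (r i)` form an instance: they are pairwise disjoint, and in their index
order they are sorted clockwise on the cycle. -/
structure IsInstance {L : ℝ} [Fact (0 < L)] {n : ℕ} [NeZero n] (l r : Fin n → AddCircle L) :
    Prop where
  sorted : StrictMono fun i => cw (l 0) (l i)
  disjoint : Pairwise fun i j => Disjoint (arc (l i) (r i)) (arc (l j) (r j))

/-- A solution has one point in each interval. -/
def Feasible {L : ℝ} [Fact (0 < L)] {n : ℕ} (l r P : Fin n → AddCircle L) : Prop :=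
  ∀ i, P i ∈ arc (l i) (r i)

/-- The minimum pairwise distance (`⊤` if there is no pair). -/
noncomputable def minDist {L : ℝ} [Fact (0 < L)] {n : ℕ} (P : Fin n → AddCircle L) : EReal :=
  ⨅ (i : Fin n) (j : Fin n) (_ : i < j), (cycleDist (P i) (P j) : EReal)

/-- A solution that maximizes the minimum pairwise distance. -/
def IsOptimal {L : ℝ} [Fact (0 < L)] {n : ℕ} (l r P : Fin n → AddCircle L) : Prop :=
  Feasible l r P ∧ ∀ Q : Fin n → AddCircle L, Feasible l r Q → minDist Q ≤ minDist P

/-- The input in memory: the integer register `0` holds `n`, the real register `0` holds the length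
of the cycle, and the cells `0, …, n - 1` of the real arrays `0` and `1` hold the coordinates of the
clockwise first and last endpoints. The rest of the memory is arbitrary. -/
def HasInput {L : ℝ} [Fact (0 < L)] {n : ℕ} (l r : Fin n → AddCircle L) (m : RealRAM.Mem) : Prop :=
  m.ireg 0 = n ∧ m.rreg 0 = L ∧
    ∀ i : Fin n, m.rarr 0 i = coord (l i) ∧ m.rarr 1 i = coord (r i)

/-- The output in memory: the cells `0, …, n - 1` of the real array `2` hold the coordinates of the
points. -/
def HasOutput {L : ℝ} [Fact (0 < L)] {n : ℕ} (P : Fin n → AddCircle L) (m : RealRAM.Mem) : Prop :=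
  ∀ i : Fin n, m.rarr 2 i = coord (P i)

end CycleDispersion

/-! Cut the cycle at the first left endpoint and unroll it for two laps, with left endpoints `A i`
and right endpoints `B i` for `i < 2n`. A solution with minimum distance `δ` lifts to points that
advance by at least `δ` at each index. So, for `n ≥ 2`, `nδ ≤ L` (one lap) and `A i + (j - i)δ ≤ B
j` for `i < j < 2n`. Let `d` be the largest number with these properties. Conversely, `d` is
attained. The greedy sequence `p (j + 1) = max (A (j + 1)) (p j + d)` has the closed form `p j =
max_{k ≤ j} (A k + (j - k)d)`, so the pair conditions give `p j ≤ B j`. The points of the second lap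
also close up around the cycle (`greedy_last_add_le`): this uses `nd ≤ L`, and the fact that a left
endpoint of the second lap has a copy one lap earlier. To find `d` in linear time, start from `L /
n` and scan `j`. The condition at `j` concerns the maximum of `A i - i * d` over `i < j`, which is
attained on the upper concave hull of the points `(i, A i)`. As `d` only decreases, the maximizer
moves to the right, so hull points passed at the front never return (`Dominates.popFront`). New
points enter at the back, as in the usual hull scan (`DominatesWith.popBack`). Each index enters and
leaves the queue at most once, and the queue length serves as the potential in the time bound. -/

namespace RealRAM

/-! ### Proof rules for timed executions -/

/-- Started with memory `m` at time `t`, the program `p` halts with a memory and at a time that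
satisfy `Q`. -/
def Run (p : Prog) (m : Mem) (t : ℕ) (Q : Mem → ℕ → Prop) : Prop :=
  ∃ s m', Exec p m s m' ∧ Q m' (t + s)

theorem Run.mono {p : Prog} {m : Mem} {t : ℕ} {Q R : Mem → ℕ → Prop} (h : Run p m t Q)
    (hQR : ∀ m t, Q m t → R m t) : Run p m t R := by
  obtain ⟨s, m', he, hq⟩ := h
  exact ⟨s, m', he, hQR _ _ hq⟩

theorem run_skip {m : Mem} {t : ℕ} {Q : Mem → ℕ → Prop} (h : Q m (t + 1)) : Run .skip m t Q :=
  ⟨1, m, .skip m, h⟩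

theorem run_instr {a : Instr} {m : Mem} {t : ℕ} {Q : Mem → ℕ → Prop}
    (h : Q (a.apply m) (t + 1)) : Run (.instr a) m t Q :=
  ⟨1, _, .instr a m, h⟩

theorem run_seq {p q : Prog} {m : Mem} {t : ℕ} {Q : Mem → ℕ → Prop}
    (h : Run p m t fun m' t' => Run q m' t' Q) : Run (.seq p q) m t Q := by
  obtain ⟨s, m', hp, s', m'', hq, h⟩ := h
  exact ⟨s + s', m'', .seq hp hq, by rwa [← add_assoc]⟩

theorem run_ite {b : Test} {p q : Prog} {m : Mem} {t : ℕ} {Q : Mem → ℕ → Prop}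
    (h₁ : b.Holds m → Run p m (t + 1) Q) (h₂ : ¬ b.Holds m → Run q m (t + 1) Q) :
    Run (.ite b p q) m t Q := by
  by_cases hb : b.Holds m
  · obtain ⟨s, m', he, h⟩ := h₁ hb
    exact ⟨1 + s, m', .ite_true hb he, by rwa [← add_assoc]⟩
  · obtain ⟨s, m', he, h⟩ := h₂ hb
    exact ⟨1 + s, m', .ite_false hb he, by rwa [← add_assoc]⟩

/-- The rule for loops. The bound `T` on the time under the invariant makes the loop terminate. -/
theorem run_loop {b : Test} {p : Prog} {Q : Mem → ℕ → Prop} (I : Mem → ℕ → Prop) (T : ℕ)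
    (hT : ∀ m t, I m t → t ≤ T)
    (h₁ : ∀ m t, I m t → b.Holds m → Run p m (t + 1) I)
    (h₂ : ∀ m t, I m t → ¬ b.Holds m → Q m (t + 1))
    {m : Mem} {t : ℕ} (h : I m t) : Run (.loop b p) m t Q := by
  -- The test alone costs a step, so the remaining time `T - t` decreases strictly with each
  -- iteration.
  induction hk : T - t using Nat.strong_induction_on generalizing m t with
  | _ k ih =>
    by_cases hb : b.Holds m
    · obtain ⟨s, m', he, h'⟩ := h₁ m t h hb
      have := hT _ _ h'
      obtain ⟨s', m'', he', h''⟩ := ih (T - (t + 1 + s)) (by omega) h' rfl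
      exact ⟨1 + s + s', m'', .loop_true hb he he', by
        rwa [show t + (1 + s + s') = t + 1 + s + s' by omega]⟩
    · exact ⟨1, m, .loop_false hb, h₂ m t h hb⟩

end RealRAM

/-! ### Upper concave hull kept in a double-ended queue -/

namespace CycleDispersion

/-- The points `x j ∈ [A j, B j]` with `x i + (j - i) * δ ≤ x j` for `i < j < N` are not excluded by
any pair of endpoints. -/
def Admissible (A B : ℕ → ℝ) (N : ℕ) (δ : ℝ) : Prop :=
  ∀ i j, i < j → j < N → A i + ((j : ℝ) - i) * δ ≤ B j

/-- The cells `h, …, e` of `q` hold increasing indices below `j` such that the points `(i, A i)` with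
these indices `i` are in concave position. -/
structure IsHull (A : ℕ → ℝ) (j : ℕ) (q : ℕ → ℕ) (h e : ℕ) : Prop where
  le : h ≤ e
  lt : q e < j
  mono : ∀ s, h ≤ s → s < e → q s < q (s + 1)
  concave : ∀ s, h ≤ s → s + 1 < e →
    (A (q (s + 2)) - A (q (s + 1))) * ((q (s + 1) : ℝ) - q s) ≤
      (A (q (s + 1)) - A (q s)) * ((q (s + 2) : ℝ) - q (s + 1))

/-- For every slope at most `d`, the maximum of `A i - i * δ` over `i < j` is attained in the cells
`h, …, e` of `q`. -/
def Dominates (A : ℕ → ℝ) (d : ℝ) (j : ℕ) (q : ℕ → ℕ) (h e : ℕ) : Prop :=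
  ∀ i < j, ∀ δ ≤ d, ∃ s, h ≤ s ∧ s ≤ e ∧ A i - i * δ ≤ A (q s) - q s * δ

/-- As `Dominates`, with the index `j` as a further candidate. -/
def DominatesWith (A : ℕ → ℝ) (d : ℝ) (j : ℕ) (q : ℕ → ℕ) (h e : ℕ) : Prop :=
  ∀ i < j, ∀ δ ≤ d,
    (∃ s, h ≤ s ∧ s ≤ e ∧ A i - i * δ ≤ A (q s) - q s * δ) ∨ A i - i * δ ≤ A j - j * δ

section Hull

variable {A : ℕ → ℝ} {d : ℝ} {j h e : ℕ} {q : ℕ → ℕ}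

theorem IsHull.lt_of_mem (H : IsHull A j q h e) {s : ℕ} (hs : h ≤ s) (hse : s ≤ e) : q s < j := by
  obtain ⟨k, rfl⟩ := Nat.exists_eq_add_of_le hse
  have H1 := H.lt
  have H2 := H.mono
  clear H
  induction k with
  | zero => exact H1
  | succ k ih =>
    refine ih (by omega) (lt_trans (H2 (s + k) (by omega) (by omega)) ?_) fun s' h1 h2 =>
      H2 s' h1 (by omega)
    exact H1

/-- Slopes decrease along a concave chain. If the first one is at most `d`, then all are, and `A i -
i * d` is largest at the front. -/
theorem IsHull.le_front (H : IsHull A j q h e)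
    (hd : h < e → A (q (h + 1)) - A (q h) ≤ ((q (h + 1) : ℝ) - q h) * d) {s : ℕ} (hs : h ≤ s)
    (hse : s ≤ e) : A (q s) - q s * d ≤ A (q h) - q h * d := by
  have step : ∀ k, h + k < e →
      A (q (h + k + 1)) - A (q (h + k)) ≤ ((q (h + k + 1) : ℝ) - q (h + k)) * d := by
    intro k
    induction k with
    | zero => intro hk; exact hd hk
    | succ k ih =>
      intro hk
      have h1 := ih (by omega)
      have h2 := H.concave (h + k) (by omega) (by omega)
      have h3 : ((q (h + k) : ℕ) : ℝ) < q (h + k + 1) := by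
        exact_mod_cast H.mono (h + k) (by omega) (by omega)
      have h4 : ((q (h + k + 1) : ℕ) : ℝ) < q (h + k + 2) := by
        exact_mod_cast H.mono (h + k + 1) (by omega) (by omega)
      have h5 := mul_le_mul_of_nonneg_right h1 (sub_nonneg.2 h4.le)
      have h6 : (A (q (h + k + 2)) - A (q (h + k + 1))) * ((q (h + k + 1) : ℝ) - q (h + k)) ≤
          (((q (h + k + 2) : ℝ) - q (h + k + 1)) * d) * ((q (h + k + 1) : ℝ) - q (h + k)) := by
        linarith
      exact le_of_mul_le_mul_right h6 (sub_pos.2 h3)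
  obtain ⟨k, rfl⟩ := Nat.exists_eq_add_of_le hs
  clear hs
  induction k with
  | zero => exact le_rfl
  | succ k ih =>
    have h1 := step k (by omega)
    have h2 := ih (by omega)
    rw [← add_assoc]
    linarith

theorem IsHull.popFront (H : IsHull A j q h e) (he : h < e) : IsHull A j q (h + 1) e :=
  ⟨he, H.lt, fun s hs => H.mono s (by omega), fun s hs => H.concave s (by omega)⟩

theorem IsHull.popBack (H : IsHull A j q h e) (he : h < e) : IsHull A j q h (e - 1) :=
  ⟨by omega, H.lt_of_mem (by omega) (by omega), fun s hs hs' => H.mono s hs (by omega),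
    fun s hs hs' => H.concave s hs (by omega)⟩

theorem Dominates.anti {d' : ℝ} (D : Dominates A d j q h e) (hd : d' ≤ d) :
    Dominates A d' j q h e :=
  fun i hi δ hδ => D i hi δ (hδ.trans hd)

/-- The segment from the front to its successor has slope at least `d`, so the successor is at least
as good for every `δ ≤ d`. The removal is therefore final while the threshold decreases. -/
theorem Dominates.popFront (H : IsHull A j q h e) (D : Dominates A d j q h e) (he : h < e)
    (hd : ((q (h + 1) : ℝ) - q h) * d ≤ A (q (h + 1)) - A (q h)) :
    Dominates A d j q (h + 1) e := by
  intro i hi δ hδ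
  obtain ⟨s, h1, h2, h3⟩ := D i hi δ hδ
  rcases eq_or_lt_of_le h1 with rfl | h1
  · refine ⟨h + 1, le_rfl, he, h3.trans ?_⟩
    have h4 : (q h : ℝ) ≤ q (h + 1) := by exact_mod_cast (H.mono h le_rfl he).le
    have := mul_le_mul_of_nonneg_left hδ (sub_nonneg.2 h4)
    linarith
  · exact ⟨s, h1, h2, h3⟩

theorem Dominates.dominatesWith (D : Dominates A d j q h e) : DominatesWith A d j q h e :=
  fun i hi δ hδ => .inl (D i hi δ hδ)

/-- A point on or below the segment between its two neighbours is never strictly better than both,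
whatever the slope `δ`. -/
theorem DominatesWith.popBack (H : IsHull A j q h e) (D : DominatesWith A d j q h e) (he : h < e)
    (hd : (A (q e) - A (q (e - 1))) * ((j : ℝ) - q e) ≤
      (A j - A (q e)) * ((q e : ℝ) - q (e - 1))) :
    DominatesWith A d j q h (e - 1) := by
  intro i hi δ hδ
  obtain ⟨s, h1, h2, h3⟩ | h3 := D i hi δ hδ
  swap
  · exact .inr h3
  rcases eq_or_lt_of_le h2 with rfl | h2
  · by_cases h4 : A (q s) - q s * δ ≤ A j - j * δ
    · exact .inr (h3.trans h4)
    refine .inl ⟨s - 1, by omega, le_rfl, h3.trans ?_⟩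
    by_contra! h5
    have h6 : (q (s - 1) : ℝ) < q s := by
      have := H.mono (s - 1) (by omega) (by omega)
      rw [Nat.sub_add_cancel (by omega)] at this
      exact_mod_cast this
    have h7 : (q s : ℝ) < j := by exact_mod_cast H.lt
    push Not at h4
    -- In the sum of `h8` and `h9` the terms with `δ` cancel, and what remains contradicts `hd`.
    have h8 : 0 < ((A (q s) - q s * δ) - (A (q (s - 1)) - q (s - 1) * δ)) * ((j : ℝ) - q s) :=
      mul_pos (sub_pos.2 h5) (sub_pos.2 h7)
    have h9 : 0 < ((A (q s) - q s * δ) - (A j - j * δ)) * ((q s : ℝ) - q (s - 1)) :=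
      mul_pos (sub_pos.2 h4) (sub_pos.2 h6)
    linarith
  · exact .inl ⟨s, h1, by omega, h3⟩

/-- The failed removal test at the back is exactly concavity at the new last triple. -/
theorem IsHull.push (H : IsHull A j q h e)
    (hd : h < e → (A j - A (q e)) * ((q e : ℝ) - q (e - 1)) ≤
      (A (q e) - A (q (e - 1))) * ((j : ℝ) - q e)) :
    IsHull A (j + 1) (Function.update q (e + 1) j) h (e + 1) := by
  have hne : ∀ s, s ≤ e → Function.update q (e + 1) j s = q s := fun s hs =>
    Function.update_of_ne (by omega) _ _
  refine ⟨H.le.trans (by omega), by simp, fun s h1 h2 => ?_, fun s h1 h2 => ?_⟩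
  · rw [hne s (by omega)]
    rcases eq_or_lt_of_le (Nat.le_of_lt_succ h2) with rfl | h2
    · simpa using H.lt
    · rw [hne _ (by omega)]
      exact H.mono s h1 h2
  · rw [hne s (by omega), hne (s + 1) (by omega)]
    rcases eq_or_lt_of_le (Nat.succ_le_of_lt h2) with h3 | h3
    · obtain rfl : e = s + 1 := by omega
      simpa using hd (by omega)
    · rw [hne _ (by omega)]
      exact H.concave s h1 (by omega)

theorem DominatesWith.push (H : IsHull A j q h e) (D : DominatesWith A d j q h e) :
    Dominates A d (j + 1) (Function.update q (e + 1) j) h (e + 1) := by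
  have := H.le
  intro i hi δ hδ
  rcases eq_or_lt_of_le (Nat.le_of_lt_succ hi) with rfl | hi
  · exact ⟨e + 1, by omega, le_rfl, by simp⟩
  obtain ⟨s, h1, h2, h3⟩ | h3 := D i hi δ hδ
  · refine ⟨s, h1, by omega, ?_⟩
    rwa [Function.update_of_ne (by omega)]
  · exact ⟨e + 1, by omega, le_rfl, by simpa using h3⟩

end Hull

end CycleDispersion

namespace RealRAM

instance : Coe Instr Prog := ⟨Prog.instr⟩

end RealRAM

/-! ### Unrolling the cycle in memory -/

namespace CycleDispersion

open RealRAM RealRAM.Instr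

/-- The representative in `[s, s + L)` of a coordinate `x`, for `s` and `x` in `[0, L)`. -/
noncomputable def shift (L s x : ℝ) : ℝ := if x < s then x + L else x

/-- The coordinates `u 0, …, u (n - 1)`, shifted to start at `s`, on two consecutive laps. -/
noncomputable def unroll (n : ℕ) (L s : ℝ) (u : ℕ → ℝ) (i : ℕ) : ℝ :=
  if i < n then shift L s (u i) else shift L s (u (i - n)) + L

/-- The registers that stay fixed after the unrolling, and the unrolled endpoints. -/
structure Unrolled (n : ℕ) (L : ℝ) (A B : ℕ → ℝ) (m : Mem) : Prop where
  size : m.ireg 0 = n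
  one : m.ireg 1 = 1
  double : m.ireg 2 = n + n
  length : m.rreg 0 = L
  left : ∀ i < n + n, m.rarr 3 i = A i
  right : ∀ i < n + n, m.rarr 4 i = B i

/-- Unrolling of the endpoints with index `ireg 3`. -/
def unrollStep : Prog :=
  .seq (rload 3 0 3) <| .seq (.ite (.rlt 3 2) (radd 3 3 0) .skip) <| .seq (rstore 3 3 3) <|
  .seq (rload 4 1 3) <| .seq (.ite (.rlt 4 2) (radd 4 4 0) .skip) <| .seq (rstore 4 3 4) <|
  .seq (iadd 6 3 0) <| .seq (radd 3 3 0) <| .seq (rstore 3 6 3) <| .seq (radd 4 4 0) <|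
  .seq (rstore 4 6 4) <| iadd 3 3 1

/-- Unrolling of all endpoints. -/
def unrollProg : Prog :=
  .seq (iconst 1 1) <| .seq (iadd 2 0 0) <| .seq (iconst 3 0) <| .seq (rload 2 0 3) <|
  .loop (.ilt 3 0) unrollStep

/-- The memory during the unrolling, when the indices below `j` are done. -/
structure UnrollInv (n : ℕ) (L : ℝ) (u v : ℕ → ℝ) (j : ℕ) (m : Mem) : Prop where
  size : m.ireg 0 = n
  one : m.ireg 1 = 1
  double : m.ireg 2 = n + n
  idx : m.ireg 3 = j
  length : m.rreg 0 = L
  start : m.rreg 2 = u 0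
  inl : ∀ i < n, m.rarr 0 i = u i
  inr : ∀ i < n, m.rarr 1 i = v i
  left : ∀ i < j, m.rarr 3 i = shift L (u 0) (u i) ∧ m.rarr 3 (i + n) = shift L (u 0) (u i) + L
  right : ∀ i < j, m.rarr 4 i = shift L (u 0) (v i) ∧ m.rarr 4 (i + n) = shift L (u 0) (v i) + L

theorem run_unrollStep {n : ℕ} {L : ℝ} {u v : ℕ → ℝ} {j t : ℕ} {m : Mem}
    (H : UnrollInv n L u v j m) (hj : j < n) :
    Run unrollStep m t fun m' t' => UnrollInv n L u v (j + 1) m' ∧ t' = t + 14 := by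
  obtain ⟨h1, h2, h3, h4, h5, h6, h7, h8, h9, h10⟩ := H
  -- The effect of storing both copies of entry `j`, stated for any array so that it serves left and
  -- right endpoints alike.
  have key : ∀ (a : ℕ → ℝ) (w : ℕ → ℝ),
      (∀ i < j, a i = shift L (u 0) (w i) ∧ a (i + n) = shift L (u 0) (w i) + L) →
      ∀ x, x = shift L (u 0) (w j) →
      ∀ i ≤ j, Function.update (Function.update a j x) (j + n) (x + L) i =
        shift L (u 0) (w i) ∧ Function.update (Function.update a j x) (j + n) (x + L) (i + n) =
        shift L (u 0) (w i) + L := by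
    rintro a w ha x rfl i hi
    rcases eq_or_lt_of_le hi with rfl | hi
    · simp [Function.update_apply]
      omega
    · simpa [Function.update_apply, show i ≠ j + n by omega, show i ≠ j by omega,
        show i + n ≠ j by omega] using ha i hi
  have hu := h7 j hj
  have hv := h8 j hj
  unfold unrollStep
  repeat first | refine run_seq ?_ | refine run_instr ?_
  refine run_ite (fun hb => ?_) (fun hb => ?_) <;>
  first | refine run_instr ?_ | refine run_skip ?_
  all_goals
    repeat first | refine run_seq ?_ | refine run_instr ?_
    refine run_ite (fun hb' => ?_) (fun hb' => ?_) <;>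
    first | refine run_instr ?_ | refine run_skip ?_
  all_goals
    repeat first | refine run_seq ?_ | refine run_instr ?_
  all_goals
    simp [Test.Holds, Instr.apply, h1, h2, h4, h5, h6, hu, hv] at hb hb' ⊢
  all_goals
    refine ⟨by simp [*], by simp [*], by simp [*], by simp [*], by simp [*], by simp [*],
       by simpa using h7, by simpa using h8, ?_, ?_⟩
  all_goals simp
  all_goals
    first
    | exact key _ _ h9 _ (by simp [shift, hb])
    | exact key _ _ h10 _ (by simp [shift, hb'])

theorem run_unrollProg {n : ℕ} (hn : 0 < n) {L : ℝ} {u v : ℕ → ℝ} {m : Mem} (h0 : m.ireg 0 = n)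
    (hL : m.rreg 0 = L) (hu : ∀ i < n, m.rarr 0 i = u i) (hv : ∀ i < n, m.rarr 1 i = v i) :
    Run unrollProg m 0 fun m' t' =>
      Unrolled n L (unroll n L (u 0) u) (unroll n L (u 0) v) m' ∧ t' ≤ 15 * n + 5 := by
  unfold unrollProg
  repeat first | refine run_seq ?_ | refine run_instr ?_
  refine run_loop (fun m t => ∃ j ≤ n, UnrollInv n L u v j m ∧ t + 15 * (n - j) ≤ 15 * n + 4)
    (15 * n + 4) ?_ ?_ ?_ ?_
  · rintro m t ⟨j, hj, -, h⟩
    omega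
  · rintro m t ⟨j, -, H, h⟩ hb
    rw [Test.Holds, H.idx, H.size] at hb
    refine (run_unrollStep H hb).mono ?_
    rintro m' t' ⟨H', rfl⟩
    exact ⟨j + 1, hb, H', by omega⟩
  · rintro m t ⟨j, hj, H, h⟩ hb
    rw [Test.Holds, H.idx, H.size] at hb
    obtain rfl : j = n := by omega
    refine ⟨⟨H.size, H.one, H.double, H.length, fun i hi => ?_, fun i hi => ?_⟩, by omega⟩
    · by_cases h : i < j
      · simp [unroll, h, H.left i h]
      · have := (H.left (i - j) (by omega)).2
        rw [Nat.sub_add_cancel (by omega)] at this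
        simp [unroll, h, this]
    · by_cases h : i < j
      · simp [unroll, h, H.right i h]
      · have := (H.right (i - j) (by omega)).2
        rw [Nat.sub_add_cancel (by omega)] at this
        simp [unroll, h, this]
  · refine ⟨0, Nat.zero_le _, ?_, by omega⟩
    simp only [Instr.apply]
    exact ⟨by simp [*], by simp [*], by simp [*], by simp [*], by simp [*],
      by simpa using hu 0 hn, by simpa using hu, by simpa using hv, by simp, by simp⟩

/-! ### Scanning for the optimal distance -/

/-- The current threshold `rreg 1` is lowered to the slope from the front of the queue to the right
endpoint `ireg 3`, and the front is removed if its successor is at least as good. -/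
def frontStep : Prog :=
  .seq (iload 6 0 4) <| .seq (rload 3 3 6) <| .seq (rload 4 4 3) <| .seq (rcast 5 6) <|
  .seq (rcast 6 3) <| .seq (rsub 4 4 3) <| .seq (rsub 6 6 5) <| .seq (rdiv 7 4 6) <|
  .seq (.ite (.rlt 7 1) (rdiv 1 4 6) .skip) <| .seq (iconst 7 0) <|
  .ite (.ilt 4 5) (
    .seq (iadd 8 4 1) <| .seq (iload 8 0 8) <| .seq (rload 8 3 8) <| .seq (rcast 9 8) <|
    .seq (rsub 8 8 3) <| .seq (rsub 9 9 5) <| .seq (rmul 9 9 1) <|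
    .ite (.rle 9 8) (.seq (iadd 4 4 1) <| iconst 7 1) .skip) .skip

/-- The back of the queue is removed if it lies below the segment from its predecessor to the left
endpoint `ireg 3`. -/
def backStep : Prog :=
  .seq (iconst 7 0) <|
  .ite (.ilt 4 5) (
    .seq (isub 6 5 1) <| .seq (iload 6 0 6) <| .seq (iload 8 0 5) <| .seq (rload 3 3 6) <|
    .seq (rload 4 3 8) <| .seq (rload 5 3 3) <| .seq (rcast 6 6) <| .seq (rcast 7 8) <|
    .seq (rcast 8 3) <| .seq (rsub 5 5 4) <| .seq (rsub 4 4 3) <| .seq (rsub 8 8 7) <|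
    .seq (rsub 7 7 6) <| .seq (rmul 4 4 8) <| .seq (rmul 5 5 7) <|
    .ite (.rle 4 5) (.seq (isub 5 5 1) <| iconst 7 1) .skip) .skip

/-- The processing of the index `ireg 3`. -/
def scanStep : Prog :=
  .seq (iconst 7 1) <| .seq (.loop (.ile 1 7) frontStep) <| .seq (iconst 7 1) <|
  .seq (.loop (.ile 1 7) backStep) <| .seq (iadd 5 5 1) <| .seq (istore 0 5 3) <| iadd 3 3 1

/-- The computation of the optimal distance. -/
def scanProg : Prog :=
  .seq (rcast 3 0) <| .seq (rdiv 1 0 3) <| .seq (iconst 3 0) <| .seq (iconst 4 0) <|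
  .seq (iconst 5 0) <| .seq (istore 0 5 3) <| .seq (iconst 3 1) <| .loop (.ilt 3 2) scanStep

/-- The memory during the scan. -/
structure Scan (n : ℕ) (L : ℝ) (A B : ℕ → ℝ) (j h e : ℕ) (d : ℝ) (q : ℕ → ℕ) (m : Mem) : Prop
    extends Unrolled n L A B m where
  idx : m.ireg 3 = j
  head : m.ireg 4 = h
  last : m.ireg 5 = e
  dist : m.rreg 1 = d
  queue : m.iarr 0 = q

theorem run_frontStep {n : ℕ} {L : ℝ} {A B : ℕ → ℝ} {j h e : ℕ} {d : ℝ} {q : ℕ → ℕ} {m : Mem}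
    {t : ℕ} (S : Scan n L A B j h e d q m) (hj : j < n + n) (H : IsHull A j q h e) :
    Run frontStep m t fun m' t' => t' ≤ t + 25 ∧ ∃ d',
      d' = min d ((B j - A (q h)) / ((j : ℝ) - q h)) ∧
      ((m'.ireg 7 = 1 ∧ h < e ∧ ((q (h + 1) : ℝ) - q h) * d' ≤ A (q (h + 1)) - A (q h) ∧
        Scan n L A B j (h + 1) e d' q m') ∨
      (m'.ireg 7 = 0 ∧ (h < e → A (q (h + 1)) - A (q h) ≤ ((q (h + 1) : ℝ) - q h) * d') ∧
        Scan n L A B j h e d' q m')) := by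
  obtain ⟨⟨h1, h2, h3, h4, h5, h6⟩, h7, h8, h9, h10, h11⟩ := S
  have f1 := h5 (q h) (by have := H.lt_of_mem le_rfl H.le; omega)
  have f2 := h6 j hj
  have f3 : h < e → m.rarr 3 (q (h + 1)) = A (q (h + 1)) := fun he =>
    h5 _ (by have := H.lt_of_mem (s := h + 1) (by omega) he; omega)
  unfold frontStep
  repeat first | refine run_seq ?_ | refine run_instr ?_
  refine run_ite (fun hb => ?_) (fun hb => ?_) <;>
  first | refine run_instr ?_ | refine run_skip ?_
  all_goals
    repeat first | refine run_seq ?_ | refine run_instr ?_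
    refine run_ite (fun hb' => ?_) (fun hb' => ?_)
  rotate_left
  · refine run_skip ?_
    simp [Test.Holds, Instr.apply, h7, h8, h9, h10, h11, f1, f2] at hb hb' ⊢
    refine ⟨fun hh => by omega, ?_⟩
    rw [min_eq_right hb.le]
    exact ⟨⟨by simp [*], by simp [*], by simp [*], by simp [*], by simpa using h5,
       by simpa using h6⟩, by simp [*], by simp [*], by simp [*], by simp [*], by simp [*]⟩
  rotate_left
  · refine run_skip ?_
    simp [Test.Holds, Instr.apply, h7, h8, h9, h10, h11, f1, f2] at hb hb' ⊢
    refine ⟨fun hh => by omega, ?_⟩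
    rw [min_eq_left hb]
    exact ⟨⟨by simp [*], by simp [*], by simp [*], by simp [*], by simpa using h5,
       by simpa using h6⟩, by simp [*], by simp [*], by simp [*], by simp [*], by simp [*]⟩
  all_goals
    repeat first | refine run_seq ?_ | refine run_instr ?_
    refine run_ite (fun hc => ?_) (fun hc => ?_)
    all_goals
      repeat first | refine run_seq ?_ | refine run_instr ?_ | refine run_skip ?_
      simp [Test.Holds, Instr.apply, h2, h7, h8, h9, h10, h11, f1, f2] at hb hb' hc ⊢
      rw [f3 hb'] at hc
      first | rw [min_eq_left hb] | rw [min_eq_right hb.le]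
  all_goals
    first | refine ⟨hb', hc, ?_⟩ | refine ⟨fun _ => by linarith, ?_⟩
    exact ⟨⟨by simp [*], by simp [*], by simp [*], by simp [*], by simpa using h5,
      by simpa using h6⟩, by simp [*], by simp [*], by simp [*], by simp [*], by simp [*]⟩

theorem run_backStep {n : ℕ} {L : ℝ} {A B : ℕ → ℝ} {j h e : ℕ} {d : ℝ} {q : ℕ → ℕ} {m : Mem}
    {t : ℕ} (S : Scan n L A B j h e d q m) (hj : j < n + n) (H : IsHull A j q h e) :
    Run backStep m t fun m' t' => t' ≤ t + 25 ∧
      ((m'.ireg 7 = 1 ∧ h < e ∧ (A (q e) - A (q (e - 1))) * ((j : ℝ) - q e) ≤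
          (A j - A (q e)) * ((q e : ℝ) - q (e - 1)) ∧
        Scan n L A B j h (e - 1) d q m') ∨
      (m'.ireg 7 = 0 ∧ (h < e → (A j - A (q e)) * ((q e : ℝ) - q (e - 1)) ≤
          (A (q e) - A (q (e - 1))) * ((j : ℝ) - q e)) ∧
        Scan n L A B j h e d q m')) := by
  obtain ⟨⟨h1, h2, h3, h4, h5, h6⟩, h7, h8, h9, h10, h11⟩ := S
  have f1 := h5 j hj
  have f2 := h5 (q e) (H.lt.trans hj)
  have f3 : h < e → m.rarr 3 (q (e - 1)) = A (q (e - 1)) := fun he =>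
    h5 _ (by have := H.lt_of_mem (s := e - 1) (by omega) (by omega); omega)
  unfold backStep
  repeat first | refine run_seq ?_ | refine run_instr ?_
  refine run_ite (fun hb => ?_) (fun hb => ?_)
  · repeat first | refine run_seq ?_ | refine run_instr ?_
    refine run_ite (fun hc => ?_) (fun hc => ?_)
    all_goals
      repeat first | refine run_seq ?_ | refine run_instr ?_ | refine run_skip ?_
      simp [Test.Holds, Instr.apply, h2, h7, h8, h9, h11, f1, f2] at hb hc ⊢
      rw [f3 hb] at hc
    · refine ⟨hb, hc, ?_⟩
      exact ⟨⟨by simp [*], by simp [*], by simp [*], by simp [*], by simpa using h5,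
        by simpa using h6⟩, by simp [*], by simp [*], by simp [*], by simp [*], by simp [*]⟩
    · refine ⟨fun _ => by linarith, ?_⟩
      exact ⟨⟨by simp [*], by simp [*], by simp [*], by simp [*], by simpa using h5,
        by simpa using h6⟩, by simp [*], by simp [*], by simp [*], by simp [*], by simp [*]⟩
  · refine run_skip ?_
    simp [Test.Holds, Instr.apply, h8, h9] at hb ⊢
    refine ⟨fun hh => by omega, ?_⟩
    exact ⟨⟨by simp [*], by simp [*], by simp [*], by simp [*], by simpa using h5,
      by simpa using h6⟩, by simp [*], by simp [*], by simp [*], by simp [*], by simp [*]⟩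

/-- `d` is an upper bound of the feasible distances, and it is feasible for the indices below `j`. -/
structure Threshold (n : ℕ) (L : ℝ) (A B : ℕ → ℝ) (j : ℕ) (d : ℝ) : Prop where
  perimeter : (n : ℝ) * d ≤ L
  admissible : Admissible A B j d
  best : ∀ δ : ℝ, (n : ℝ) * δ ≤ L → Admissible A B (n + n) δ → δ ≤ d

section

variable {n : ℕ} {L : ℝ} {A B : ℕ → ℝ} {j h e : ℕ} {d : ℝ} {q : ℕ → ℕ}

theorem Admissible.anti {d' : ℝ} (H : Admissible A B j d) (hd : d' ≤ d) : Admissible A B j d' := by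
  intro i k hik hk
  have h1 : (i : ℝ) ≤ k := by exact_mod_cast hik.le
  have := mul_le_mul_of_nonneg_left hd (sub_nonneg.2 h1)
  linarith [H i k hik hk]

/-- The new slope is itself one of the constraints on `δ`, so `d` remains an upper bound. -/
theorem Threshold.lower (H : Threshold n L A B j d) (hj : j < n + n) {i : ℕ} (hi : i < j) :
    Threshold n L A B j (min d ((B j - A i) / ((j : ℝ) - i))) where
  perimeter := (mul_le_mul_of_nonneg_left (min_le_left _ _) n.cast_nonneg).trans H.perimeter
  admissible := H.admissible.anti (min_le_left _ _)
  best δ h1 h2 := by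
    have h3 : (i : ℝ) < j := by exact_mod_cast hi
    refine le_min (H.best δ h1 h2) ((le_div_iff₀ (sub_pos.2 h3)).2 ?_)
    linarith [h2 i j hi hj]

/-- The constraints at `j` reduce to the one from the front: every `i < j` is dominated by a queue
cell, and every cell by the front. -/
theorem Threshold.succ (H : Threshold n L A B j d) (D : Dominates A d j q h e)
    (hull : IsHull A j q h e)
    (hd : h < e → A (q (h + 1)) - A (q h) ≤ ((q (h + 1) : ℝ) - q h) * d)
    (hB : d ≤ (B j - A (q h)) / ((j : ℝ) - q h)) : Threshold n L A B (j + 1) d where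
  perimeter := H.perimeter
  best := H.best
  admissible i k hik hk := by
    rcases eq_or_lt_of_le (Nat.le_of_lt_succ hk) with rfl | hk
    · have h3 : (q h : ℝ) < k := by exact_mod_cast hull.lt_of_mem le_rfl hull.le
      rw [le_div_iff₀ (sub_pos.2 h3)] at hB
      obtain ⟨s, h1, h2, h4⟩ := D i hik d le_rfl
      linarith [hull.le_front hd h1 h2]
    · exact H.admissible i k hik hk

theorem Scan.setFlag {m : Mem} (S : Scan n L A B j h e d q m) :
    Scan n L A B j h e d q ((iconst 7 1).apply m) := by
  obtain ⟨⟨h1, h2, h3, h4, h5, h6⟩, h7, h8, h9, h10, h11⟩ := S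
  simp only [Instr.apply]
  exact ⟨⟨by simp [*], by simp [*], by simp [*], by simp [*], by simpa using h5,
    by simpa using h6⟩, by simp [*], by simp [*], by simp [*], by simp [*], by simp [*]⟩

/-- A successful iteration is paid for by the cell it removes, at 30 steps per cell; the extra 30
pay for the final iteration, which removes nothing. That iteration certifies the front as maximizer,
so the threshold becomes valid at `j`. -/
theorem run_frontLoop {T t : ℕ} {m : Mem} (hj : j < n + n) (S : Scan n L A B j h e d q m)
    (hull : IsHull A j q h e) (D : Dominates A d j q h e) (H : Threshold n L A B j d)
    (hflag : m.ireg 7 = 1) (ht : t + 30 * (e - h) + 30 ≤ T) :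
    Run (.loop (.ile 1 7) frontStep) m t fun m' t' => ∃ h' d', Scan n L A B j h' e d' q m' ∧
      IsHull A j q h' e ∧ Dominates A d' j q h' e ∧ Threshold n L A B (j + 1) d' ∧
      t' + 30 * (e - h') ≤ T + 1 := by
  refine run_loop (fun m t => ∃ h d, Scan n L A B j h e d q m ∧ IsHull A j q h e ∧
    Dominates A d j q h e ∧
    ((m.ireg 7 = 1 ∧ Threshold n L A B j d ∧ t + 30 * (e - h) + 30 ≤ T) ∨
      (m.ireg 7 = 0 ∧ Threshold n L A B (j + 1) d ∧ t + 30 * (e - h) ≤ T))) T ?_ ?_ ?_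
    ⟨h, d, S, hull, D, .inl ⟨hflag, H, ht⟩⟩
  · rintro m t ⟨h, d, -, -, -, H⟩
    omega
  · rintro m t ⟨h, d, S, hull, D, ⟨-, H, ht⟩ | ⟨h0, -⟩⟩ hb
    · refine (run_frontStep S hj hull).mono ?_
      rintro m' t' ⟨ht', d', hd', ⟨h1, he, h2, S'⟩ | ⟨h1, h2, S'⟩⟩
      · subst hd'
        have D' := D.anti (min_le_left d ((B j - A (q h)) / ((j : ℝ) - q h)))
        exact ⟨h + 1, _, S', hull.popFront he, D'.popFront hull he h2,
          .inl ⟨h1, H.lower hj (hull.lt_of_mem le_rfl hull.le), by omega⟩⟩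
      · subst hd'
        have D' := D.anti (min_le_left d ((B j - A (q h)) / ((j : ℝ) - q h)))
        exact ⟨h, _, S', hull, D', .inr ⟨h1, (H.lower hj (hull.lt_of_mem le_rfl hull.le)).succ D'
          hull h2 (min_le_right _ _), by omega⟩⟩
    · rw [Test.Holds, S.one, h0] at hb
      omega
  · rintro m t ⟨h, d, S, hull, D, ⟨h0, -⟩ | ⟨-, H, ht⟩⟩ hb
    · rw [Test.Holds, S.one, h0] at hb
      omega
    · exact ⟨h, d, S, hull, D, H, by omega⟩

theorem run_backLoop {T t : ℕ} {m : Mem} (hj : j < n + n) (S : Scan n L A B j h e d q m)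
    (hull : IsHull A j q h e) (D : DominatesWith A d j q h e)
    (hflag : m.ireg 7 = 1) (ht : t + 30 * (e - h) + 30 ≤ T) :
    Run (.loop (.ile 1 7) backStep) m t fun m' t' => ∃ e', Scan n L A B j h e' d q m' ∧
      IsHull A j q h e' ∧ DominatesWith A d j q h e' ∧
      (h < e' → (A j - A (q e')) * ((q e' : ℝ) - q (e' - 1)) ≤
        (A (q e') - A (q (e' - 1))) * ((j : ℝ) - q e')) ∧
      t' + 30 * (e' - h) ≤ T + 1 := by
  refine run_loop (fun m t => ∃ e, Scan n L A B j h e d q m ∧ IsHull A j q h e ∧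
    DominatesWith A d j q h e ∧
    ((m.ireg 7 = 1 ∧ t + 30 * (e - h) + 30 ≤ T) ∨
      (m.ireg 7 = 0 ∧ (h < e → (A j - A (q e)) * ((q e : ℝ) - q (e - 1)) ≤
        (A (q e) - A (q (e - 1))) * ((j : ℝ) - q e)) ∧ t + 30 * (e - h) ≤ T))) T ?_ ?_ ?_
    ⟨e, S, hull, D, .inl ⟨hflag, ht⟩⟩
  · rintro m t ⟨e, -, -, -, H⟩
    omega
  · rintro m t ⟨e, S, hull, D, ⟨-, ht⟩ | ⟨h0, -⟩⟩ hb
    · refine (run_backStep S hj hull).mono ?_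
      rintro m' t' ⟨ht', ⟨h1, he, h2, S'⟩ | ⟨h1, h2, S'⟩⟩
      · exact ⟨e - 1, S', hull.popBack he, D.popBack hull he h2, .inl ⟨h1, by omega⟩⟩
      · exact ⟨e, S', hull, D, .inr ⟨h1, h2, by omega⟩⟩
    · rw [Test.Holds, S.one, h0] at hb
      omega
  · rintro m t ⟨e, S, hull, D, ⟨h0, -⟩ | ⟨-, H, ht⟩⟩ hb
    · rw [Test.Holds, S.one, h0] at hb
      omega
    · exact ⟨e, S, hull, D, H, by omega⟩

theorem run_scanStep {T t : ℕ} {m : Mem} (hj : j < n + n) (S : Scan n L A B j h e d q m)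
    (hull : IsHull A j q h e) (D : Dominates A d j q h e) (H : Threshold n L A B j d)
    (ht : t + 30 * (e - h) + 99 ≤ T) :
    Run scanStep m t fun m' t' => ∃ h' e' d' q', Scan n L A B (j + 1) h' e' d' q' m' ∧
      IsHull A (j + 1) q' h' e' ∧ Dominates A d' (j + 1) q' h' e' ∧
      Threshold n L A B (j + 1) d' ∧ t' + 30 * (e' - h') ≤ T := by
  refine run_seq (run_instr (run_seq ?_))
  -- The budget 99 covers the final iterations of the two loops (60), the potential of the pushed
  -- cell (30) and the remaining steps.
  refine (run_frontLoop (T := T - 68) hj S.setFlag hull D H (by simp [Instr.apply]) (by omega)).mono ?_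
  have hT : 99 ≤ T := by omega
  clear S hull D H ht
  rintro m t ⟨h, d, S, hull, D, H, ht⟩
  refine run_seq (run_instr (run_seq ?_))
  refine (run_backLoop (T := T - 36) hj S.setFlag hull D.dominatesWith (by simp [Instr.apply])
    (by omega)).mono ?_
  clear S hull D ht
  rintro m t ⟨e, S, hull, D, hd, ht⟩
  repeat first | refine run_seq ?_ | refine run_instr ?_
  refine ⟨h, e + 1, d, Function.update q (e + 1) j, ?_, hull.push hd, D.push hull, H, ?_⟩
  · obtain ⟨⟨h1, h2, h3, h4, h5, h6⟩, h7, h8, h9, h10, h11⟩ := S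
    simp only [Instr.apply]
    exact ⟨⟨by simp [*], by simp [*], by simp [*], by simp [*], by simpa using h5,
      by simpa using h6⟩, by simp [*], by simp [*], by simp [*], by simp [*], by simp [*]⟩
  · have := hull.le
    omega

theorem run_scanProg {T t : ℕ} {m : Mem} (hn : 0 < n) (U : Unrolled n L A B m)
    (ht : t + 200 * n + 9 ≤ T) :
    Run scanProg m t fun m' t' => Unrolled n L A B m' ∧ Threshold n L A B (n + n) (m'.rreg 1) ∧
      t' ≤ T := by
  unfold scanProg
  repeat first | refine run_seq ?_ | refine run_instr ?_
  refine run_loop (fun m t => ∃ j h e d q, Scan n L A B j h e d q m ∧ IsHull A j q h e ∧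
    Dominates A d j q h e ∧ Threshold n L A B j d ∧ j ≤ n + n ∧
    t + 30 * (e - h) + 100 * (n + n - j) + 1 ≤ T) T ?_ ?_ ?_ ?_
  · rintro m t ⟨j, h, e, d, q, -, -, -, -, -, ht⟩
    omega
  · rintro m t ⟨j, h, e, d, q, S, hull, D, H, hj, ht⟩ hb
    rw [Test.Holds, S.idx, S.double] at hb
    refine (run_scanStep (T := T - 100 * (n + n - (j + 1)) - 1) hb S hull D H (by omega)).mono ?_
    rintro m' t' ⟨h', e', d', q', S', hull', D', H', ht'⟩
    exact ⟨j + 1, h', e', d', q', S', hull', D', H', hb, by omega⟩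
  · rintro m t ⟨j, h, e, d, q, S, hull, D, H, hj, ht⟩ hb
    rw [Test.Holds, S.idx, S.double] at hb
    obtain rfl : j = n + n := by omega
    rw [S.dist]
    exact ⟨S.toUnrolled, H, by omega⟩
  · have hn' : (0 : ℝ) < n := by exact_mod_cast hn
    obtain ⟨h1, h2, h3, h4, h5, h6⟩ := U
    -- Initially only the perimeter bounds the distance, there is no pair below `1`, and the queue
    -- consists of the index `0`.
    refine ⟨1, 0, 0, L / n, Function.update (m.iarr 0) 0 0, ?_, ⟨le_rfl, by simp, by omega, by omega⟩,
      ?_, ⟨by rw [mul_div_cancel₀ _ hn'.ne'], by intro i j h1 h2; omega, fun δ hδ _ => ?_⟩,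
      by omega, by omega⟩
    · simp only [Instr.apply]
      exact ⟨⟨by simp [*], by simp [*], by simp [*], by simp [*], by simpa using h5,
        by simpa using h6⟩, by simp [*], by simp [*], by simp [*], by simp [*], by simp [*]⟩
    · intro i hi δ hδ
      obtain rfl : i = 0 := by omega
      exact ⟨0, le_rfl, le_rfl, by simp⟩
    · rw [le_div_iff₀ hn']
      linarith

end

/-! ### Computing the greedy points -/

/-- The leftmost points to the right of the endpoints `A` with consecutive distances at least `d`. -/
noncomputable def greedy (A : ℕ → ℝ) (d : ℝ) : ℕ → ℝ
  | 0 => A 0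
  | j + 1 => max (A (j + 1)) (greedy A d j + d)

/-- The representative in `[0, L)` of a coordinate in `[0, 2 * L)`. -/
noncomputable def wrap (L x : ℝ) : ℝ := if L ≤ x then x - L else x

/-- Computation of the greedy point with index `ireg 3`, and its output on the second lap. -/
def greedyStep : Prog :=
  .seq (radd 3 3 1) <| .seq (rload 4 3 3) <| .seq (.ite (.rlt 3 4) (rload 3 3 3) .skip) <|
  .seq (.ite (.ile 0 3) (
    .seq (isub 6 3 0) <| .seq (rsub 5 3 0) <| .seq (.ite (.rle 0 5) (rsub 5 5 0) .skip) <|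
    rstore 2 6 5) .skip) <|
  iadd 3 3 1

/-- The computation of the points from the optimal distance. -/
def greedyProg : Prog :=
  .seq (iconst 3 0) <| .seq (rload 3 3 3) <| .seq (iconst 3 1) <| .loop (.ilt 3 2) greedyStep

/-- The memory during the greedy phase, when the points up to `j` are computed. -/
structure GreedyInv (n : ℕ) (L : ℝ) (A B : ℕ → ℝ) (d : ℝ) (j : ℕ) (m : Mem) : Prop
    extends Unrolled n L A B m where
  idx : m.ireg 3 = j + 1
  dist : m.rreg 1 = d
  point : m.rreg 3 = greedy A d j
  out : ∀ i, i + n ≤ j → m.rarr 2 i = wrap L (greedy A d (i + n) - L)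

variable {n : ℕ} {L : ℝ} {A B : ℕ → ℝ}

theorem run_greedyStep {j t : ℕ} {d : ℝ} {m : Mem} (G : GreedyInv n L A B d j m)
    (hj : j + 1 < n + n) :
    Run greedyStep m t fun m' t' => GreedyInv n L A B d (j + 1) m' ∧ t' ≤ t + 12 := by
  obtain ⟨⟨h1, h2, h3, h4, h5, h6⟩, h7, h8, h9, h10⟩ := G
  have f1 := h5 _ hj
  have key : n ≤ j + 1 → ∀ x, x = wrap L (greedy A d (j + 1) - L) → ∀ i, i + n ≤ j + 1 →
      Function.update (m.rarr 2) (j + 1 - n) x i = wrap L (greedy A d (i + n) - L) := by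
    rintro hn x rfl i hi
    by_cases hij : i = j + 1 - n
    · subst hij
      rw [Function.update_self, Nat.sub_add_cancel hn]
    · rw [Function.update_of_ne hij]
      exact h10 i (by omega)
  have key' : j + 1 < n → ∀ i, i + n ≤ j + 1 → m.rarr 2 i = wrap L (greedy A d (i + n) - L) :=
    fun hn i hi => h10 i (by omega)
  unfold greedyStep
  repeat first | refine run_seq ?_ | refine run_instr ?_
  refine run_ite (fun hb => ?_) (fun hb => ?_) <;>
  first | refine run_instr ?_ | refine run_skip ?_
  all_goals
    refine run_seq (run_ite (fun hb' => ?_) (fun hb' => ?_))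
    rotate_left
    · repeat first | refine run_seq ?_ | refine run_instr ?_ | refine run_skip ?_
      simp [Test.Holds, Instr.apply, h1, h7, h8, h9, f1] at hb hb' ⊢
      refine ⟨⟨by simp [*], by simp [*], by simp [*], by simp [*], by simpa using h5,
        by simpa using h6⟩, by simp [*], by simp [*], ?_, by simpa using key' hb'⟩
      first
      | simp [greedy, max_eq_left hb.le]
      | simp [greedy, max_eq_right hb]
    repeat first | refine run_seq ?_ | refine run_instr ?_
    refine run_ite (fun hc => ?_) (fun hc => ?_)
    all_goals
      repeat first | refine run_seq ?_ | refine run_instr ?_ | refine run_skip ?_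
      simp [Test.Holds, Instr.apply, h1, h2, h4, h7, h8, h9, f1] at hb hb' hc ⊢
      have hg : greedy A d (j + 1) = max (A (j + 1)) (greedy A d j + d) := rfl
      first
      | rw [max_eq_left hb.le] at hg
      | rw [max_eq_right hb] at hg
      refine ⟨⟨by simp [*], by simp [*], by simp [*], by simp [*], by simpa using h5,
        by simpa using h6⟩, by simp [*], by simp [*], by simp [hg], ?_⟩
      simp only [Function.update_self]
      refine key hb' _ ?_
      simp [wrap, hg, hc]

theorem run_greedyProg {T t : ℕ} {m : Mem} (hn : 0 < n) (U : Unrolled n L A B m)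
    (ht : t + 30 * n + 3 ≤ T) :
    Run greedyProg m t fun m' t' =>
      (∀ i < n, m'.rarr 2 i = wrap L (greedy A (m.rreg 1) (i + n) - L)) ∧ t' ≤ T := by
  unfold greedyProg
  repeat first | refine run_seq ?_ | refine run_instr ?_
  refine run_loop (fun m' t => ∃ j, GreedyInv n L A B (m.rreg 1) j m' ∧ j + 1 ≤ n + n ∧
    t + 13 * (n + n - (j + 1)) + 1 ≤ T) T ?_ ?_ ?_ ?_
  · rintro m t ⟨j, -, -, ht⟩
    omega
  · rintro m t ⟨j, G, hj, ht⟩ hb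
    rw [Test.Holds, G.idx, G.double] at hb
    refine (run_greedyStep G hb).mono ?_
    rintro m' t' ⟨G', ht'⟩
    exact ⟨j + 1, G', hb, by omega⟩
  · rintro m t ⟨j, G, hj, ht⟩ hb
    rw [Test.Holds, G.idx, G.double] at hb
    exact ⟨fun i hi => G.out i (by omega), by omega⟩
  · obtain ⟨h1, h2, h3, h4, h5, h6⟩ := U
    have := h5 0 (by omega)
    refine ⟨0, ?_, by omega, by omega⟩
    simp only [Instr.apply]
    exact ⟨⟨by simp [*], by simp [*], by simp [*], by simp [*], by simpa using h5,
        by simpa using h6⟩, by simp [*], by simp [*], by simp [greedy, this],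
        fun i hi => by omega⟩

/-- The linear-time algorithm. -/
def dispersionProg : Prog :=
  .seq unrollProg (.seq scanProg greedyProg)

theorem run_dispersionProg {u v : ℕ → ℝ} {m : Mem} (hn : 0 < n)
    (h0 : m.ireg 0 = n) (hL : m.rreg 0 = L) (hu : ∀ i < n, m.rarr 0 i = u i)
    (hv : ∀ i < n, m.rarr 1 i = v i) :
    Run dispersionProg m 0 fun m' t' => t' ≤ 262 * n ∧ ∃ d,
      Threshold n L (unroll n L (u 0) u) (unroll n L (u 0) v) (n + n) d ∧
      ∀ i < n, m'.rarr 2 i = wrap L (greedy (unroll n L (u 0) u) d (i + n) - L) := by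
  refine run_seq ((run_unrollProg hn h0 hL hu hv).mono ?_)
  rintro m₁ t₁ ⟨U, ht₁⟩
  refine run_seq ((run_scanProg (T := 215 * n + 14) hn U (by omega)).mono ?_)
  rintro m₂ t₂ ⟨U, H, ht₂⟩
  refine (run_greedyProg (T := 245 * n + 17) hn U (by omega)).mono ?_
  rintro m₃ t₃ ⟨ho, ht₃⟩
  -- The total is at most `245 * n + 17`, and `17 ≤ 17 * n`.
  exact ⟨by omega, _, H, ho⟩

end CycleDispersion

namespace CycleDispersion

/-! ### The closed form of the greedy sequence -/

section Greedy

variable {n : ℕ} {L d : ℝ} {A B : ℕ → ℝ}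

theorem le_greedy (j : ℕ) : A j ≤ greedy A d j := by
  cases j with
  | zero => exact le_rfl
  | succ j => exact le_max_left _ _

theorem add_mul_le_greedy {k j : ℕ} (h : k ≤ j) : A k + ((j : ℝ) - k) * d ≤ greedy A d j := by
  induction j, h using Nat.le_induction with
  | base => simpa using le_greedy k
  | succ j hj ih =>
    refine le_trans ?_ (le_max_right _ _)
    push_cast
    linarith

theorem greedy_add_mul_le {k j : ℕ} (h : k ≤ j) :
    greedy A d k + ((j : ℝ) - k) * d ≤ greedy A d j := by
  induction j, h using Nat.le_induction with
  | base => simp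
  | succ j hj ih =>
    refine le_trans ?_ (le_max_right _ _)
    push_cast
    linarith

/-- Here `k` is an index where the sequence last sat at its left endpoint. With `add_mul_le_greedy`
this gives the closed form as a maximum. -/
theorem exists_greedy_eq (j : ℕ) : ∃ k ≤ j, greedy A d j = A k + ((j : ℝ) - k) * d := by
  induction j with
  | zero => exact ⟨0, le_rfl, by simp [greedy]⟩
  | succ j ih =>
    rcases max_choice (A (j + 1)) (greedy A d j + d) with h | h
    · exact ⟨j + 1, le_rfl, by rw [greedy, h]; simp⟩
    · obtain ⟨k, hk, e⟩ := ih
      refine ⟨k, hk.trans (Nat.le_succ j), ?_⟩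
      rw [greedy, h, e]
      push_cast
      ring

theorem greedy_le {N j : ℕ} (H : Admissible A B N d) (hj : j < N) (hAB : A j ≤ B j) :
    greedy A d j ≤ B j := by
  obtain ⟨k, hk, e⟩ := exists_greedy_eq (A := A) (d := d) j
  rw [e]
  rcases eq_or_lt_of_le hk with rfl | hk
  · simpa using hAB
  · exact H k j hk hj

/-- Trace the last point back to its left endpoint `k`. If `k ≤ n`, the chain from `k` passes the
index `n`, and the `n` further gaps fit into `L`. Otherwise the copy `k - n` on the first lap pushes
the point at index `n` far enough. -/
theorem greedy_last_add_le (hd : (n : ℝ) * d ≤ L) (hn : 0 < n)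
    (hA : ∀ i < n, A (i + n) = A i + L) :
    greedy A d (n - 1 + n) + d ≤ greedy A d (0 + n) + L := by
  obtain ⟨k, hk, e⟩ := exists_greedy_eq (A := A) (d := d) (n - 1 + n)
  have hc : ((n - 1 + n : ℕ) : ℝ) = n + n - 1 := by
    rw [Nat.cast_add, Nat.cast_sub hn]
    push_cast
    ring
  rw [e, hc, zero_add]
  by_cases hkn : k ≤ n
  · have := add_mul_le_greedy (A := A) (d := d) hkn
    linarith
  · have h1 := hA (k - n) (by omega)
    rw [Nat.sub_add_cancel (by omega)] at h1
    have h2 := add_mul_le_greedy (A := A) (d := d) (k := k - n) (j := n) (by omega)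
    rw [Nat.cast_sub (by omega)] at h2
    rw [h1]
    linarith

end Greedy

/-! ### Spaced points satisfy the constraints -/

/-- Two laps of a sequence. -/
noncomputable def laps (n : ℕ) (L : ℝ) (y : ℕ → ℝ) (i : ℕ) : ℝ :=
  if i < n then y i else y (i - n) + L

section Laps

variable {n : ℕ} {L δ : ℝ} {a b y : ℕ → ℝ}

theorem laps_of_lt {i : ℕ} (hi : i < n) : laps n L y i = y i := if_pos hi

theorem laps_add (i : ℕ) : laps n L y (i + n) = y i + L := by simp [laps]

theorem laps_le_laps (h : ∀ i < n, a i ≤ b i) {i : ℕ} (hi : i < n + n) :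
    laps n L a i ≤ laps n L b i := by
  unfold laps
  split_ifs with h'
  · exact h i h'
  · have := h (i - n) (by omega)
    linarith

theorem laps_spaced (hn : 0 < n) (h1 : ∀ i, i + 1 < n → y i + δ ≤ y (i + 1))
    (h2 : y (n - 1) + δ ≤ y 0 + L) {i j : ℕ} (hij : i ≤ j) (hj : j < n + n) :
    laps n L y i + ((j : ℝ) - i) * δ ≤ laps n L y j := by
  induction j, hij using Nat.le_induction with
  | base => simp
  | succ j hij ih =>
    have h3 : laps n L y j + δ ≤ laps n L y (j + 1) := by
      rcases lt_trichotomy (j + 1) n with h | h | h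
      · rw [laps_of_lt h, laps_of_lt (by omega)]
        exact h1 j h
      · subst h
        simpa [laps] using h2
      · have := h1 (j - n) (by omega)
        rw [show j - n + 1 = j + 1 - n by omega] at this
        simp only [laps, if_neg (show ¬ j < n by omega), if_neg (show ¬ j + 1 < n by omega)]
        linarith
    have := ih (by omega)
    push_cast
    linarith

theorem admissible_of_spaced (hn : 0 < n) (hay : ∀ i < n, a i ≤ y i) (hyb : ∀ i < n, y i ≤ b i)
    (h1 : ∀ i, i + 1 < n → y i + δ ≤ y (i + 1)) (h2 : y (n - 1) + δ ≤ y 0 + L) :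
    (n : ℝ) * δ ≤ L ∧ Admissible (laps n L a) (laps n L b) (n + n) δ := by
  constructor
  · have := laps_spaced hn h1 h2 (Nat.zero_le n) (by omega)
    simp [laps, hn] at this
    linarith
  · intro i j hij hj
    linarith [laps_le_laps (L := L) hay (hij.trans hj), laps_le_laps (L := L) hyb hj,
      laps_spaced hn h1 h2 hij.le hj]

end Laps

/-! ### Coordinates on the circle -/

section Circle

variable {L : ℝ}

theorem coe_add_length (x : ℝ) : ((x + L : ℝ) : AddCircle L) = x := by simp

theorem coe_shift (s x : ℝ) : ((shift L s x : ℝ) : AddCircle L) = x := by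
  unfold shift
  split_ifs <;> simp

theorem coe_wrap (x : ℝ) : ((wrap L x : ℝ) : AddCircle L) = x := by
  unfold wrap
  split_ifs <;> simp

theorem le_shift {s x : ℝ} (hs : s < L) (hx : 0 ≤ x) : s ≤ shift L s x := by
  unfold shift
  split_ifs <;> linarith

theorem shift_lt {s x : ℝ} (hs : 0 ≤ s) (hx : x < L) : shift L s x < s + L := by
  unfold shift
  split_ifs <;> linarith

variable [Fact (0 < L)]

theorem coord_nonneg (p : AddCircle L) : 0 ≤ coord p := (AddCircle.equivIco L 0 p).2.1

theorem coord_lt (p : AddCircle L) : coord p < L := by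
  exact (AddCircle.equivIco L 0 p).2.2.trans_eq (zero_add L)

theorem coe_coord (p : AddCircle L) : ((coord p : ℝ) : AddCircle L) = p :=
  (AddCircle.equivIco L 0).symm_apply_apply p

theorem coord_coe {x : ℝ} (h0 : 0 ≤ x) (hx : x < L) : coord (x : AddCircle L) = x := by
  have h : x ∈ Set.Ico 0 (0 + L) := ⟨h0, by simpa using hx⟩
  exact congrArg Subtype.val ((AddCircle.equivIco L 0).apply_symm_apply ⟨x, h⟩)

theorem cw_nonneg (p q : AddCircle L) : 0 ≤ cw p q := coord_nonneg _

theorem cw_coe {x y : ℝ} (h : x ≤ y) (h' : y < x + L) :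
    cw (x : AddCircle L) (y : AddCircle L) = y - x := by
  rw [cw, ← AddCircle.coe_sub]
  exact coord_coe (by linarith) (by linarith)

theorem cw_coe_of_lt {x y : ℝ} (h : y < x) (h' : x ≤ y + L) :
    cw (x : AddCircle L) (y : AddCircle L) = y + L - x := by
  rw [← coe_add_length y]
  exact cw_coe h' (by linarith)

theorem coord_coe_wrap {x : ℝ} (h0 : 0 ≤ x) (hx : x < L + L) :
    coord ((x : ℝ) : AddCircle L) = wrap L x := by
  rw [← coe_wrap, coord_coe] <;> unfold wrap <;> split_ifs <;> linarith

end Circle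

/-! ### Lifting the arcs to the line -/

section Instance

variable {L : ℝ} [Fact (0 < L)] {n : ℕ} [NeZero n]

/-- The coordinate of `p` in the fundamental domain that starts at `o`. -/
noncomputable def lift (o p : AddCircle L) : ℝ := shift L (coord o) (coord p)

theorem coe_lift (o p : AddCircle L) : ((lift o p : ℝ) : AddCircle L) = p := by
  rw [lift, coe_shift, coe_coord]

theorem le_lift (o p : AddCircle L) : coord o ≤ lift o p := le_shift (coord_lt o) (coord_nonneg p)

theorem lift_lt (o p : AddCircle L) : lift o p < coord o + L := shift_lt (coord_nonneg o) (coord_lt p)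

theorem lift_self (o : AddCircle L) : lift o o = coord o := by simp [lift, shift]

theorem cw_eq_lift_sub (o : AddCircle L) {p q : AddCircle L} (h : lift o p ≤ lift o q) :
    cw p q = lift o q - lift o p := by
  conv_lhs => rw [← coe_lift o p, ← coe_lift o q]
  exact cw_coe h (by linarith [lift_lt o q, le_lift o p])

theorem cw_eq_lift_add_sub (o : AddCircle L) {p q : AddCircle L} (h : lift o q < lift o p) :
    cw p q = lift o q + L - lift o p := by
  conv_lhs => rw [← coe_lift o p, ← coe_lift o q]
  exact cw_coe_of_lt h (by linarith [lift_lt o p, le_lift o q])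

theorem left_mem_arc (l r : AddCircle L) : l ∈ arc l r := by
  change cw l l ≤ cw l r
  rw [cw_eq_lift_sub l le_rfl, sub_self]
  exact cw_nonneg _ _

variable {l r : Fin n → AddCircle L}

theorem IsInstance.lift_left_lt (H : IsInstance l r) {i j : Fin n} (hij : i < j) :
    lift (l 0) (l i) < lift (l 0) (l j) := by
  have h := H.sorted hij
  simp only at h
  rw [cw_eq_lift_sub (l 0) (by rw [lift_self]; exact le_lift _ _),
    cw_eq_lift_sub (l 0) (by rw [lift_self]; exact le_lift _ _)] at h
  linarith

/-- An arc that straddled the cut at `l 0` would contain `l 0`, against disjointness. So every arc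
lifts to an honest interval. -/
theorem IsInstance.lift_le (H : IsInstance l r) (i : Fin n) :
    lift (l 0) (l i) ≤ lift (l 0) (r i) := by
  by_contra! h
  have h0 : lift (l 0) (l 0) < lift (l 0) (l i) := by
    rw [lift_self]
    exact (le_lift _ _).trans_lt h
  have hi : i ≠ 0 := by
    rintro rfl
    exact lt_irrefl _ h0
  refine Set.disjoint_left.1 (H.disjoint hi) ?_ (left_mem_arc (l 0) (r 0))
  change cw _ _ ≤ cw _ _
  rw [cw_eq_lift_add_sub (l 0) h, cw_eq_lift_add_sub (l 0) h0, lift_self]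
  linarith [le_lift (l 0) (r i)]

theorem IsInstance.lift_right_lt (H : IsInstance l r) {i j : Fin n} (hij : i < j) :
    lift (l 0) (r i) < lift (l 0) (l j) := by
  by_contra! h
  refine Set.disjoint_left.1 (H.disjoint hij.ne) ?_ (left_mem_arc (l j) (r j))
  change cw _ _ ≤ cw _ _
  rw [cw_eq_lift_sub (l 0) (H.lift_le i), cw_eq_lift_sub (l 0) (H.lift_left_lt hij).le]
  linarith

theorem IsInstance.coe_mem_arc (H : IsInstance l r) {i : Fin n} {x : ℝ}
    (h1 : lift (l 0) (l i) ≤ x) (h2 : x ≤ lift (l 0) (r i)) :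
    (x : AddCircle L) ∈ arc (l i) (r i) := by
  change cw _ _ ≤ cw _ _
  rw [cw_eq_lift_sub (l 0) (H.lift_le i)]
  conv_lhs => rw [← coe_lift (l 0) (l i)]
  rw [cw_coe h1 (by linarith [lift_lt (l 0) (r i), le_lift (l 0) (l i)])]
  linarith

theorem IsInstance.exists_coe_eq (H : IsInstance l r) {i : Fin n} {p : AddCircle L}
    (hp : p ∈ arc (l i) (r i)) :
    ∃ x : ℝ, lift (l 0) (l i) ≤ x ∧ x ≤ lift (l 0) (r i) ∧ (x : AddCircle L) = p := by
  change cw _ _ ≤ cw _ _ at hp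
  rw [cw_eq_lift_sub (l 0) (H.lift_le i)] at hp
  refine ⟨lift (l 0) (l i) + cw (l i) p, by linarith [cw_nonneg (l i) p], by linarith, ?_⟩
  rw [AddCircle.coe_add, coe_lift, cw, coe_coord, add_sub_cancel]

end Instance

/-! ### Feasibility and optimality of the output -/

section Optimality

variable {L : ℝ} [Fact (0 < L)] {n : ℕ} [NeZero n] {l r : Fin n → AddCircle L} {d : ℝ}

/-- The lifts of points on the cycle, indexed by natural numbers. -/
noncomputable def lifts (o : AddCircle L) (p : Fin n → AddCircle L) (i : ℕ) : ℝ :=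
  lift o (p (Fin.ofNat n i))

theorem lifts_val (o : AddCircle L) (p : Fin n → AddCircle L) (i : Fin n) :
    lifts o p i = lift o (p i) := by
  simp [lifts]

/-- The threshold that the algorithm computes. -/
abbrev IsThreshold (l r : Fin n → AddCircle L) (d : ℝ) : Prop :=
  Threshold n L (laps n L (lifts (l 0) l)) (laps n L (lifts (l 0) r)) (n + n) d

/-- The lifts of the output points. -/
noncomputable def point (l : Fin n → AddCircle L) (d : ℝ) (i : Fin n) : ℝ :=
  greedy (laps n L (lifts (l 0) l)) d (i + n) - L

theorem le_of_spaced (T : IsThreshold l r d) {δ : ℝ} {y : Fin n → ℝ}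
    (hl : ∀ i, lift (l 0) (l i) ≤ y i) (hr : ∀ i, y i ≤ lift (l 0) (r i))
    (h1 : ∀ i j, i < j → y i + δ ≤ y j) (h2 : ∀ i : Fin n, (i : ℕ) = n - 1 → y i + δ ≤ y 0 + L) :
    δ ≤ d := by
  have hn := NeZero.pos n
  obtain ⟨h3, h4⟩ := admissible_of_spaced (y := fun i => y (Fin.ofNat n i))
    (a := lifts (l 0) l) (b := lifts (l 0) r) hn (fun i _ => hl _) (fun i _ => hr _)
    (fun i hi => h1 _ _ (by
      rw [Fin.lt_def, Fin.val_ofNat, Fin.val_ofNat, Nat.mod_eq_of_lt hi,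
        Nat.mod_eq_of_lt (by omega)]
      omega)) (h2 _ (by rw [Fin.val_ofNat, Nat.mod_eq_of_lt (by omega)]))
  exact T.best δ h3 h4

/-- The left endpoints are a selection with spacing `0`. The sign of `d` is what carries the spacing
from neighbours to all pairs. -/
theorem IsInstance.threshold_nonneg (H : IsInstance l r) (T : IsThreshold l r d) : 0 ≤ d := by
  refine le_of_spaced T (y := fun i => lift (l 0) (l i)) (fun _ => le_rfl) H.lift_le
    (fun i j hij => by simpa using (H.lift_left_lt hij).le) fun i _ => ?_
  rw [add_zero, lift_self]
  exact (lift_lt _ _).le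

theorem lift_le_point (i : Fin n) : lift (l 0) (l i) ≤ point l d i := by
  have := le_greedy (A := laps n L (lifts (l 0) l)) (d := d) (i + n)
  rw [laps_add, lifts_val] at this
  rw [point]
  linarith

theorem IsInstance.point_le (H : IsInstance l r) (T : IsThreshold l r d) (i : Fin n) :
    point l d i ≤ lift (l 0) (r i) := by
  have := greedy_le T.admissible (j := i + n) (by omega) (by
    simpa only [laps_add, lifts_val, add_le_add_iff_right] using H.lift_le i)
  rw [laps_add, lifts_val] at this
  rw [point]
  linarith

theorem point_add_le (hd : 0 ≤ d) {i j : Fin n} (hij : i < j) : point l d i + d ≤ point l d j := by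
  have h1 := greedy_add_mul_le (A := laps n L (lifts (l 0) l)) (d := d) (k := i + n)
    (j := j + n) (by have := Fin.lt_def.1 hij; omega)
  have h2 : (i : ℝ) + 1 ≤ (j : ℕ) := by exact_mod_cast Fin.lt_def.1 hij
  have h3 : 1 * d ≤ ((j : ℕ) - (i : ℕ) : ℝ) * d := mul_le_mul_of_nonneg_right (by linarith) hd
  push_cast at h1
  rw [point, point]
  linarith

theorem point_last_add_le (T : IsThreshold l r d) (hd : 0 ≤ d) (i j : Fin n) :
    point l d j + d ≤ point l d i + L := by
  have h1 := greedy_last_add_le (A := laps n L (lifts (l 0) l)) T.perimeter (NeZero.pos n)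
    fun i hi => by rw [laps_add, laps_of_lt hi]
  have mono : ∀ k m : ℕ, k ≤ m → greedy (laps n L (lifts (l 0) l)) d (k + n) ≤
      greedy (laps n L (lifts (l 0) l)) d (m + n) := by
    intro k m hkm
    have h2 := greedy_add_mul_le (A := laps n L (lifts (l 0) l)) (d := d)
      (Nat.add_le_add_right hkm n)
    have h3 : (k : ℝ) ≤ m := by exact_mod_cast hkm
    have h4 := mul_nonneg (sub_nonneg.2 h3) hd
    push_cast at h2
    linarith
  have h2 := mono 0 i (Nat.zero_le _)
  have h3 := mono j (n - 1) (by omega)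
  rw [point, point]
  linarith

theorem IsInstance.le_cycleDist_point (H : IsInstance l r) (T : IsThreshold l r d) {i j : Fin n}
    (hij : i < j) : d ≤ cycleDist (point l d i : AddCircle L) (point l d j : AddCircle L) := by
  have hd := H.threshold_nonneg T
  have h1 := point_add_le (l := l) hd hij
  have h2 : point l d j < point l d i + L := by
    linarith [H.point_le T j, lift_lt (l 0) (r j), le_lift (l 0) (l i),
      lift_le_point (l := l) (d := d) i]
  refine le_min ?_ ?_
  · rw [cw_coe (by linarith) h2]
    linarith
  · rcases eq_or_lt_of_le (show point l d i ≤ point l d j by linarith) with h | h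
    -- Coinciding points force `d ≤ 0`.
    · exact le_trans (by linarith) (cw_nonneg _ _)
    · rw [cw_coe_of_lt h h2.le]
      linarith [point_last_add_le T hd i j]

theorem IsInstance.le_threshold (H : IsInstance l r) (T : IsThreshold l r d) (hn : n ≠ 1)
    {Q : Fin n → AddCircle L} (hQ : Feasible l r Q) {δ : ℝ}
    (hδ : ∀ i j, i < j → δ ≤ cycleDist (Q i) (Q j)) : δ ≤ d := by
  choose y h1 h2 h3 using fun i => H.exists_coe_eq (hQ i)
  have hlt : ∀ i j, i < j → y i < y j := fun i j hij =>
    ((h2 i).trans_lt (H.lift_right_lt hij)).trans_le (h1 j)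
  have hL : ∀ i j, y j < y i + L := fun i j => by
    linarith [h2 j, lift_lt (l 0) (r j), le_lift (l 0) (l i), h1 i]
  refine le_of_spaced T h1 h2 (fun i j hij => ?_) fun i hi => ?_
  · have h := (hδ i j hij).trans (min_le_left _ _)
    rw [← h3 i, ← h3 j, cw_coe (hlt i j hij).le (hL i j)] at h
    linarith
  · have hi0 : 0 < i := by
      rw [Fin.lt_def, Fin.val_zero, hi]
      have := NeZero.pos n
      omega
    have h := (hδ 0 i hi0).trans (min_le_right _ _)
    rw [← h3 i, ← h3 0, cw_coe_of_lt (hlt 0 i hi0) (hL 0 i).le] at h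
    linarith

theorem IsInstance.isOptimal_point (H : IsInstance l r) (T : IsThreshold l r d) :
    IsOptimal l r fun i => (point l d i : AddCircle L) := by
  refine ⟨fun i => H.coe_mem_arc (lift_le_point i) (H.point_le T i), fun Q hQ => ?_⟩
  refine le_iInf fun i => le_iInf fun j => le_iInf fun hij => ?_
  refine le_trans ?_ (EReal.coe_le_coe_iff.2 (H.le_cycleDist_point T hij))
  by_contra! h
  -- `minDist Q` is an extended real, so a real number above `d` is inserted below it.
  obtain ⟨δ, h1, h2⟩ := EReal.lt_iff_exists_real_btwn.1 h
  have hn : n ≠ 1 := by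
    rintro rfl
    exact hij.ne (Subsingleton.elim i j)
  refine (EReal.coe_lt_coe_iff.1 h1).not_ge (H.le_threshold T hn hQ fun i j hij => ?_)
  exact EReal.coe_le_coe_iff.1 (h2.le.trans (iInf_le_of_le i (iInf_le_of_le j (iInf_le _ hij))))

theorem IsInstance.coord_point (H : IsInstance l r) (T : IsThreshold l r d) (i : Fin n) :
    coord (point l d i : AddCircle L) = wrap L (point l d i) := by
  refine coord_coe_wrap ?_ ?_
  · linarith [coord_nonneg (l 0), le_lift (l 0) (l i), lift_le_point (l := l) (d := d) i]
  · linarith [coord_lt (l 0), lift_lt (l 0) (r i), H.point_le T i]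

end Optimality

end CycleDispersion

theorem theorem2 :
    ∃ (prog : RealRAM.Prog) (c : ℕ),
      ∀ (n : ℕ) [NeZero n] (L : ℝ) [Fact (0 < L)] (l r : Fin n → AddCircle L),
        CycleDispersion.IsInstance l r →
        ∀ m : RealRAM.Mem, CycleDispersion.HasInput l r m →
          ∃ (t : ℕ) (m' : RealRAM.Mem) (P : Fin n → AddCircle L),
            RealRAM.Exec prog m t m' ∧ t ≤ c * n ∧
            CycleDispersion.HasOutput P m' ∧ CycleDispersion.IsOptimal l r P := by
  refine ⟨CycleDispersion.dispersionProg, 262, fun n _ L _ l r H m ⟨h0, hL, hin⟩ => ?_⟩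
  have hof : ∀ i (hi : i < n), Fin.ofNat n i = ⟨i, hi⟩ := fun i hi =>
    Fin.ext (Nat.mod_eq_of_lt hi)
  obtain ⟨t, m', hexec, ht, d, T, hout⟩ := CycleDispersion.run_dispersionProg
    (u := fun i => CycleDispersion.coord (l (Fin.ofNat n i)))
    (v := fun i => CycleDispersion.coord (r (Fin.ofNat n i))) (NeZero.pos n) h0 hL
    (fun i hi => by rw [hof i hi]; exact (hin ⟨i, hi⟩).1)
    (fun i hi => by rw [hof i hi]; exact (hin ⟨i, hi⟩).2)
  -- Unrolled coordinates are, by definition, two laps of the lifts.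
  have T' : CycleDispersion.IsThreshold l r d := T
  refine ⟨t, m', _, hexec, by simpa using ht, fun i => ?_, H.isOptimal_point T'⟩
  rw [H.coord_point T' i]
  exact hout i i.2
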